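/- Let $K=\mathrm{GF}(3^2)$ and let $\zeta\in K$ satisfy $\zeta^2=1-\zeta$. Let $\mathrm{M}(3^2)$ be the group of all permutations of $\mathbb{P}^1(K)=K\cup\{\infty\}$ of the form $\omega\mapsto\frac{r\beta(\omega)+s}{t\beta(\omega)+u}$ with $r,s,t,u\in K$, $\Delta=ru-st\neq0$, where $\beta$ is the identity if $\Delta$ is a square in $K^\times$, and $\beta(\omega)=\omega^3$ (with $\beta(\infty)=\infty$) otherwise. Let $v\notin\mathbb{P}^1(K)$ be a new point, let $\mathrm{M}(3^2)$ act on the eleven points $\mathbb{P}^1(K)\cup\{v\}$ by fixing $v$, and let $S_4$ be the permutation of these points given by $S_4(\infty)=v$, $S_4(v)=\infty$, and $S_4(x+\zeta y)=x-\zeta y$ for $x,y\in\mathrm{GF}(3)$. The Mathieu group $M_{11}$ is the permutation group $\langle \mathrm{M}(3^2),S_4\rangle$ of degree $11$ (permutations are composed as maps acting from the left). Write $[x,y]=xyx^{-1}y^{-1}$ and $x^y=y^{-1}xy$. Then $M_{11}$ has a presentation with generators $a,T,J,U$ and defining relations $$T^2=J^2=(JT)^3=(Ta^2)^3=[J,a]^4=(J[J,a])^2=1,\quad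 a^2=[J,a]^2,\quad (aT)^2=T^{[J,a]}$$ (the relations of $\mathrm{M}(3^2)$), together with $$U^2=(UT)^2=(UJ)^3=1,\quad a^U=[J,a],$$ where $a,T,J$ correspond to the elements $a:\omega\mapsto\zeta^{-1}\omega^3$, $T:\omega\mapsto1-\omega$, $J:\omega\mapsto\omega^{-1}$ of $\mathrm{M}(3^2)$ (fixing $v$), and $U$ corresponds to $S_4$. -/

import Mathlib

noncomputable section

namespace Mathieu

/-- The field `K = GF(3^2)`. -/
abbrev K : Type := GaloisField 3 2

/-- The projective line `ℙ¹(K) = K ∪ {∞}`, on which `GL₂(K)` acts by Möbius transformations. -/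
abbrev Line : Type := OnePoint K

/-- The set `ℙ¹(K) ∪ {v}` of eleven points; the new point `v` is `Option.none`. -/
abbrev Points : Type := Option Line

/-- The involutory field automorphism `ω ↦ ω³` of `K`. -/
def conj : K →+* K := frobenius K 3

lemma conj_conj (x : K) : conj (conj x) = x := by
  have hc : Nat.card K = 9 := by
    have := GaloisField.card 3 2 (by norm_num)
    norm_num at this
    exact this
  have : Fintype K := Fintype.ofFinite K
  have h := FiniteField.pow_card x
  rw [← Nat.card_eq_fintype_card, hc] at h
  simp only [conj, frobenius_def, ← pow_mul]
  exact h

open scoped Classical in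
/-- The map `β` attached to a matrix `A`: the identity on `ℙ¹(K)` if `det A` is a square in `Kˣ`,
and the map `ω ↦ ω³`, `∞ ↦ ∞` otherwise. -/
def twist (A : GL (Fin 2) K) (ω : Line) : Line :=
  if IsSquare (Matrix.GeneralLinearGroup.det A) then ω else OnePoint.map conj ω

lemma map_conj_conj (ω : Line) : OnePoint.map conj (OnePoint.map conj ω) = ω := by
  cases ω with
  | none => rfl
  | some x => exact congrArg OnePoint.some (conj_conj x)

lemma isSquare_mul_iff (x y : Kˣ) : IsSquare (x * y) ↔ (IsSquare x ↔ IsSquare y) := by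
  have : Fintype K := Fintype.ofFinite K
  classical
  have hF : ringChar K ≠ 2 := by
    rw [ringChar.eq K 3]
    decide
  have key : ∀ z : Kˣ, IsSquare z ↔ quadraticChar K (z : K) = 1 := by
    intro z
    rw [quadraticChar_one_iff_isSquare z.ne_zero]
    constructor
    · rintro ⟨w, rfl⟩
      exact ⟨w, by simp⟩
    · rintro ⟨w, hw⟩
      have hw0 : w ≠ 0 := by
        rintro rfl
        exact z.ne_zero (by rw [hw, mul_zero])
      exact ⟨Units.mk0 w hw0, Units.ext (by simpa using hw)⟩
  rw [key, key, key, Units.val_mul, map_mul]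
  rcases quadraticChar_dichotomy x.ne_zero with hx | hx <;>
    rcases quadraticChar_dichotomy y.ne_zero with hy | hy <;> rw [hx, hy] <;> decide

lemma isSquare_map_conj_iff (x : Kˣ) : IsSquare (Units.map (conj : K →* K) x) ↔ IsSquare x := by
  constructor
  · intro h
    have h2 := h.map (Units.map (conj : K →* K))
    have : Units.map (conj : K →* K) (Units.map (conj : K →* K) x) = x := by
      ext
      simp [conj_conj]
    rwa [this] at h2
  · intro h
    exact h.map _

open scoped Classical in
lemma zassenhaus_mul (A B : GL (Fin 2) K) : ∃ C : GL (Fin 2) K, ∀ ω : Line,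
    C • twist C ω = A • twist A (B • twist B ω) := by
  by_cases hA : IsSquare (Matrix.GeneralLinearGroup.det A)
  · refine ⟨A * B, fun ω => ?_⟩
    have : twist (A * B) ω = twist B ω := by
      simp [twist, isSquare_mul_iff, hA]
    rw [this, mul_smul]
    congr 1
    simp [twist, hA]
  · refine ⟨A * B.map conj, fun ω => ?_⟩
    have hd : Matrix.GeneralLinearGroup.det (B.map conj) =
        Units.map (conj : K →* K) (Matrix.GeneralLinearGroup.det B) := by
      ext
      simp [Matrix.GeneralLinearGroup.map, RingHom.map_det]
    have : twist (A * B.map conj) ω = OnePoint.map conj (twist B ω) := by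
      by_cases hB : IsSquare (Matrix.GeneralLinearGroup.det B)
      · simp [twist, isSquare_mul_iff, hA, hd, hB, isSquare_map_conj_iff]
      · simp [twist, isSquare_mul_iff, hA, hd, hB, isSquare_map_conj_iff, map_conj_conj]
    rw [this, mul_smul, ← OnePoint.map_smul]
    congr 1
    simp [twist, hA]

open scoped Classical in
/-- The Zassenhaus group `M(3²)`: all permutations
`ω ↦ (a β(ω) + b) / (c β(ω) + d)` of `ℙ¹(K)`, where `ad - bc ≠ 0` and `β` is the identity if
`ad - bc` is a square in `Kˣ`, and `ω ↦ ω³` otherwise. -/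
def M9 : Subgroup (Equiv.Perm Line) where
  carrier := {h | ∃ A : GL (Fin 2) K, ∀ ω : Line, h ω = A • twist A ω}
  one_mem' := ⟨1, fun ω => by simp [twist]⟩
  mul_mem' := by
    rintro g h ⟨A, hA⟩ ⟨B, hB⟩
    obtain ⟨C, hC⟩ := zassenhaus_mul A B
    exact ⟨C, fun ω => by rw [hC, Equiv.Perm.mul_apply, hA, hB]⟩
  inv_mem' := by
    rintro g ⟨A, hA⟩
    by_cases h : IsSquare (Matrix.GeneralLinearGroup.det A)
    · refine ⟨A⁻¹, fun ω => ?_⟩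
      rw [Equiv.Perm.inv_eq_iff_eq, hA]
      simp [twist, h]
    · refine ⟨(A⁻¹).map conj, fun ω => ?_⟩
      have hd : Matrix.GeneralLinearGroup.det ((A⁻¹).map conj) =
          Units.map (conj : K →* K) (Matrix.GeneralLinearGroup.det A⁻¹) := by
        ext
        simp [Matrix.GeneralLinearGroup.map, RingHom.map_det]
      have h2 : ¬ IsSquare (Matrix.GeneralLinearGroup.det ((A⁻¹).map conj)) := by
        rw [hd, isSquare_map_conj_iff]
        simpa using h
      rw [Equiv.Perm.inv_eq_iff_eq, hA]
      simp only [twist, h, h2, if_false]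
      rw [← OnePoint.map_smul, map_conj_conj, smul_inv_smul]

/-- Coordinates on `K` with respect to the basis `1, ζ` over the prime field. -/
lemma bijective_coord (ζ : K) (hζ : ζ ^ 2 = 1 - ζ) : Function.Bijective
    (fun p : ZMod 3 × ZMod 3 => algebraMap (ZMod 3) K p.1 + ζ * algebraMap (ZMod 3) K p.2) := by
  have hc : Nat.card K = 9 := by
    have := GaloisField.card 3 2 (by norm_num)
    norm_num at this
    exact this
  rw [Nat.bijective_iff_injective_and_card]
  refine ⟨?_, by rw [hc]; simp⟩
  have hinj := (algebraMap (ZMod 3) K).injective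
  have hroot : ∀ c : ZMod 3, algebraMap (ZMod 3) K c ≠ ζ := by
    rintro c rfl
    have h : c ^ 2 = 1 - c := hinj (by simpa using hζ)
    have hall : ∀ d : ZMod 3, d ^ 2 ≠ 1 - d := by decide
    exact hall c h
  rintro ⟨a, b⟩ ⟨a', b'⟩ h
  simp only at h
  by_cases hb : b = b'
  · subst hb
    have := hinj (add_right_cancel h)
    rw [this]
  · exfalso
    have hne : algebraMap (ZMod 3) K (b - b') ≠ 0 := by
      rw [Ne, map_eq_zero]
      exact sub_ne_zero.mpr hb
    apply hroot ((a' - a) / (b - b'))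
    rw [map_div₀, div_eq_iff hne, map_sub, map_sub]
    linear_combination -h

/-- The bijection `(α, β) ↦ α + ζ β`. -/
def coord (ζ : K) (hζ : ζ ^ 2 = 1 - ζ) : ZMod 3 × ZMod 3 ≃ K :=
  Equiv.ofBijective _ (bijective_coord ζ hζ)

/-- The map `α + ζ β ↦ α - ζ β` of `K` onto itself (`α, β` in the prime field). -/
def reflect (ζ : K) (hζ : ζ ^ 2 = 1 - ζ) (x : K) : K :=
  coord ζ hζ (((coord ζ hζ).symm x).1, -((coord ζ hζ).symm x).2)

lemma reflect_apply (ζ : K) (hζ : ζ ^ 2 = 1 - ζ) (α β : ZMod 3) :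
    reflect ζ hζ (algebraMap (ZMod 3) K α + ζ * algebraMap (ZMod 3) K β) =
      algebraMap (ZMod 3) K α - ζ * algebraMap (ZMod 3) K β := by
  have h : algebraMap (ZMod 3) K α + ζ * algebraMap (ZMod 3) K β = coord ζ hζ (α, β) := rfl
  rw [h, reflect, Equiv.symm_apply_apply]
  simp [coord, sub_eq_add_neg]

lemma reflect_reflect (ζ : K) (hζ : ζ ^ 2 = 1 - ζ) (x : K) :
    reflect ζ hζ (reflect ζ hζ x) = x := by
  simp [reflect]

/-- The underlying map of `S₄`. -/
def s4Fun (ζ : K) (hζ : ζ ^ 2 = 1 - ζ) : Points → Points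
  | none => some OnePoint.infty
  | some OnePoint.infty => none
  | some (OnePoint.some x) => some (OnePoint.some (reflect ζ hζ x))

/-- The permutation `S₄` of the eleven points: it interchanges `v` and `∞`, and sends
`α + ζ β` to `α - ζ β`. -/
def S4 (ζ : K) (hζ : ζ ^ 2 = 1 - ζ) : Equiv.Perm Points :=
  Function.Involutive.toPerm (s4Fun ζ hζ) (by
    rintro (_ | _ | x)
    · rfl
    · rfl
    · exact congrArg (fun y : K => (some (OnePoint.some y) : Points)) (reflect_reflect ζ hζ x))

/-- The Mathieu group `M₁₁`, as a permutation group of degree eleven: the group generated by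
`M(3²)`, acting on the eleven points with `v` fixed, and `S₄`. -/
def M11 (ζ : K) (hζ : ζ ^ 2 = 1 - ζ) : Subgroup (Equiv.Perm Points) :=
  Subgroup.closure ({g | ∃ h ∈ M9, g = Equiv.optionCongr h} ∪ {S4 ζ hζ})

/-- The transformation `a : ω ↦ ζ⁻¹ ω³`, fixing `∞` and `v`. -/
def aMap (ζ : K) : Points → Points
  | none => none
  | some OnePoint.infty => some OnePoint.infty
  | some (OnePoint.some x) => some (OnePoint.some (ζ⁻¹ * x ^ 3))

/-- The transformation `T : ω ↦ 1 - ω`, fixing `∞` and `v`. -/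
def tMap : Points → Points
  | none => none
  | some OnePoint.infty => some OnePoint.infty
  | some (OnePoint.some x) => some (OnePoint.some (1 - x))

open scoped Classical in
/-- The transformation `J : ω ↦ ω⁻¹`, interchanging `0` and `∞` and fixing `v`. -/
def jMap : Points → Points
  | none => none
  | some OnePoint.infty => some (OnePoint.some 0)
  | some (OnePoint.some x) => if x = 0 then some OnePoint.infty else some (OnePoint.some x⁻¹)

/-- The four generating symbols. -/
inductive Gen : Type
  | a
  | T
  | J
  | U

/-- The commutator `[x, y] = x y x⁻¹ y⁻¹`. -/
def comm {G : Type*} [Group G] (x y : G) : G := x * y * x⁻¹ * y⁻¹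

/-- The conjugate `x ^ y = y⁻¹ x y`. -/
def conjBy {G : Type*} [Group G] (x y : G) : G := y⁻¹ * x * y

/-- The defining relators; a relation `x = y` is recorded as `x * y⁻¹`. The first set contains the
relators of `M(3²)`, the second one those involving `U`. -/
def rels : Set (FreeGroup Gen) :=
  let a := FreeGroup.of Gen.a
  let T := FreeGroup.of Gen.T
  let J := FreeGroup.of Gen.J
  let U := FreeGroup.of Gen.U
  {T ^ 2, J ^ 2, (J * T) ^ 3, (T * a ^ 2) ^ 3, comm J a ^ 4, (J * comm J a) ^ 2,
    a ^ 2 * (comm J a ^ 2)⁻¹, (a * T) ^ 2 * (conjBy T (comm J a))⁻¹} ∪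
  {U ^ 2, (U * T) ^ 2, (U * J) ^ 3, conjBy a U * (comm J a)⁻¹}

end Mathieu

end

namespace Mathieu

/-! Writing `K` in the basis 1, ζ turns the four transformations into permutations of a finite set
with decidable equality, where the relators are checked by computation (`lift_genPerm_eq_one`). This
gives an action of the presented group on the eleven points. What remains is that this action is
faithful and that its image is M₁₁.

Faithfulness comes from a stabilizer chain read off from the relations. Put b = [J, a] and t = T a²,
which acts as ω ↦ ω + 1. The relations make Q = ⟨a, b⟩ a quotient of the quaternion group, make N =
⟨t, a t a⁻¹⟩ abelian and normalized by Q, and make the nontrivial elements of N the Q-conjugates of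
t. Hence B = ⟨a, b, T⟩ equals NQ. The braid relations for J, T and for U, J then yield H = B ∪ BJB
for H = ⟨a, b, T, J⟩ (`IsZassenhausTuple.mem_or_exists_eq`) and H ∪ HUH for the whole group
(`IsMathieuTuple.mem_or_exists_eq_mul`). Since U moves v, J moves ∞ and t moves 0, an element fixing
v, ∞, 0 lies in Q, and one that also fixes 1 is trivial (`act_injective`). No coset enumeration or
order of M₁₁ is needed.

For the image, H acts triply transitively on the projective line (`exists_act_eq`) and lands in
M(3²), where only the identity fixes ∞, 0 and 1 (`eq_one_of_mem_M9`). So H maps onto M(3²), and U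
supplies S₄ (`range_action`). -/

/-! ### The presented group acting on eleven points in coordinates -/

/-- The eleven points in coordinates: the affine point `x + ζ y` is recorded as `(x, y)`. -/
abbrev Pt : Type := Option (Option (ZMod 3 × ZMod 3))

/-- The permutation of the coordinate points that fixes `v` and `∞` and acts as `f` elsewhere. -/
def affinePerm (f g : ZMod 3 × ZMod 3 → ZMod 3 × ZMod 3)
    (h₁ : ∀ p, g (f p) = p) (h₂ : ∀ p, f (g p) = p) : Equiv.Perm Pt where
  toFun := Option.map (Option.map f)
  invFun := Option.map (Option.map g)
  left_inv := by rintro (_ | _ | p) <;> simp [h₁]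
  right_inv := by rintro (_ | _ | p) <;> simp [h₂]

/-- The transformation `ω ↦ ζ⁻¹ ω³` in coordinates. -/
def aPerm : Equiv.Perm Pt :=
  affinePerm (fun p => (p.1 + p.2, p.1 - p.2)) (fun p => (-p.1 - p.2, p.2 - p.1))
    (by decide) (by decide)

/-- The transformation `ω ↦ 1 - ω` in coordinates. -/
def tPerm : Equiv.Perm Pt :=
  affinePerm (fun p => (1 - p.1, -p.2)) (fun p => (1 - p.1, -p.2)) (by decide) (by decide)

/-- The underlying map of `jPerm`. -/
def jFun : Pt → Pt
  | none => none
  | some none => some (some 0)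
  | some (some p) => if p = 0 then some none else
      some (some ((p.1 - p.2) * (p.1 ^ 2 - p.1 * p.2 - p.2 ^ 2),
        -p.2 * (p.1 ^ 2 - p.1 * p.2 - p.2 ^ 2)))

/-- The transformation `ω ↦ ω⁻¹` in coordinates. -/
def jPerm : Equiv.Perm Pt := Function.Involutive.toPerm jFun (by unfold Function.Involutive; decide)

/-- The underlying map of `uPerm`. -/
def uFun : Pt → Pt
  | none => some none
  | some none => none
  | some (some p) => some (some (p.1, -p.2))

/-- The permutation `S₄` in coordinates. -/
def uPerm : Equiv.Perm Pt := Function.Involutive.toPerm uFun (by unfold Function.Involutive; decide)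

/-- The permutations attached to the generating symbols, in coordinates. -/
def genPerm : Gen → Equiv.Perm Pt
  | .a => aPerm
  | .T => tPerm
  | .J => jPerm
  | .U => uPerm

lemma lift_genPerm_eq_one : ∀ r ∈ rels, FreeGroup.lift genPerm r = 1 := by
  rintro r ((rfl | rfl | rfl | rfl | rfl | rfl | rfl | rfl) | (rfl | rfl | rfl | rfl)) <;>
    simp only [comm, conjBy, map_mul, map_pow, map_inv, FreeGroup.lift_apply_of, genPerm] <;>
    decide +kernel

/-- The action of the presented group on the coordinate points. -/
def act : PresentedGroup rels →* Equiv.Perm Pt :=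
  PresentedGroup.toGroup lift_genPerm_eq_one

lemma act_of (x : Gen) : act (PresentedGroup.of x) = genPerm x :=
  PresentedGroup.toGroup.of _

/-! ### Consequences of the relations for the stabilizer of ∞ -/

section AffineTriple

variable {G : Type*} [Group G]

/-- Elements `a`, `b`, `T` that satisfy the relations of the stabilizer of `∞` in `M(3²)`: the
elements `a`, `b` generate a quaternion group, and `T * a ^ 2` is a translation. -/
structure IsAffineTriple (a b T : G) : Prop where
  sq_eq : b * b = a * a
  sq_sq : a * a * (a * a) = 1
  aba : a * b * a = b
  T_mul_T : T * T = 1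
  cube : (T * (a * a)) ^ 3 = 1
  conj_T : a * T * (a * T) = b⁻¹ * T * b

namespace IsAffineTriple

variable {a b T : G} (h : IsAffineTriple a b T)
include h

lemma inv_sq : (a * a)⁻¹ = a * a := inv_eq_of_mul_eq_one_left h.sq_sq

lemma a_inv : a⁻¹ = a * a * a :=
  inv_eq_of_mul_eq_one_left (by simpa [mul_assoc] using h.sq_sq)

lemma b_inv : b⁻¹ = b * b * b :=
  inv_eq_of_mul_eq_one_left (by
    have := h.sq_sq
    rw [← h.sq_eq] at this
    simpa [mul_assoc] using this)

lemma b_eq : b = a * a * b⁻¹ := by rw [← h.sq_eq]; group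

lemma conj_sq_translation :
    MulAut.conj (a * a) (T * (a * a)) = (T * (a * a))⁻¹ := by
  rw [MulAut.conj_apply, h.inv_sq, mul_inv_rev, h.inv_sq, inv_eq_of_mul_eq_one_left h.T_mul_T]
  rw [mul_assoc (a * a), mul_assoc T, h.sq_sq, mul_one]

/-- The relation (aT)² = b⁻¹Tb, multiplied on the right by a² = b², which commutes with b. -/
lemma conj_b_inv_translation :
    MulAut.conj b⁻¹ (T * (a * a)) = MulAut.conj a (T * (a * a)) * (T * (a * a)) := by
  have h1 : b * (a * a) = a * a * b := by rw [← h.sq_eq, mul_assoc]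
  calc MulAut.conj b⁻¹ (T * (a * a)) = b⁻¹ * T * (a * a * b) := by
        simp [mul_assoc]
    _ = b⁻¹ * T * b * (a * a) := by rw [← h1]; simp only [mul_assoc]
    _ = a * T * (a * T) * (a * a) := by rw [h.conj_T]
    _ = _ := by simp [mul_assoc]

lemma conj_sq_conj :
    MulAut.conj (a * a) (MulAut.conj a (T * (a * a))) = (MulAut.conj a (T * (a * a)))⁻¹ := by
  rw [← map_inv, ← h.conj_sq_translation, ← MulAut.mul_apply, ← MulAut.mul_apply, ← map_mul,
    ← map_mul, mul_assoc]

/-- Write t = T a² and s = a t a⁻¹. Conjugation by a² = b² inverts t, s and b⁻¹ t b, the last being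
s t. Inverting both factors and their product forces s and t to commute. -/
lemma commute : Commute (T * (a * a)) (MulAut.conj a (T * (a * a))) := by
  have h1 : MulAut.conj (a * a) (MulAut.conj b⁻¹ (T * (a * a))) =
      (MulAut.conj b⁻¹ (T * (a * a)))⁻¹ := by
    rw [← map_inv, ← h.conj_sq_translation, ← MulAut.mul_apply, ← MulAut.mul_apply, ← map_mul,
      ← map_mul, ← h.sq_eq]
    congr 2
    group
  rw [h.conj_b_inv_translation, map_mul, h.conj_sq_conj, h.conj_sq_translation] at h1
  have h2 := congrArg (·⁻¹) h1
  simp only [mul_inv_rev, inv_inv] at h2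
  exact h2

lemma conj_a_conj : MulAut.conj a (MulAut.conj a (T * (a * a))) = (T * (a * a))⁻¹ := by
  rw [← MulAut.mul_apply, ← map_mul, h.conj_sq_translation]

lemma conj_b_translation : MulAut.conj b (T * (a * a)) =
    (T * (a * a))⁻¹ * (MulAut.conj a (T * (a * a)))⁻¹ := by
  rw [h.b_eq, map_mul MulAut.conj, MulAut.mul_apply, h.conj_b_inv_translation, map_mul, h.conj_sq_conj,
    h.conj_sq_translation]
  exact (h.commute.inv_inv).eq.symm

/-- With t = T a² and s = a t a⁻¹, undoing b⁻¹ t b = s t gives b s b⁻¹ = t (b t b⁻¹)⁻¹ = t s t. This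
is t² s, and t has order dividing 3. -/
lemma conj_b_conj : MulAut.conj b (MulAut.conj a (T * (a * a))) =
    (T * (a * a))⁻¹ * MulAut.conj a (T * (a * a)) := by
  have h1 : MulAut.conj b (MulAut.conj b⁻¹ (T * (a * a))) = T * (a * a) := by
    rw [← MulAut.mul_apply, ← map_mul, mul_inv_cancel, map_one, MulAut.one_apply]
  rw [h.conj_b_inv_translation, map_mul, h.conj_b_translation, ← eq_mul_inv_iff_mul_eq] at h1
  rw [h1]
  have h2 := h.commute.eq
  have h3 := h.cube
  generalize MulAut.conj a (T * (a * a)) = A at *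
  generalize T * (a * a) = t at *
  have h4 : t⁻¹ = t * t := inv_eq_of_mul_eq_one_left (by rw [← h3, pow_succ, pow_two])
  rw [mul_inv_rev, inv_inv, inv_inv, h4, ← h2, mul_assoc]

/-- Every element of the quaternion group has the form `a ^ i * b ^ j`. -/
lemma exists_zpow_mul_zpow {q : G} (hq : q ∈ Subgroup.closure {a, b}) :
    ∃ i j : ℤ, q = a ^ i * b ^ j := by
  -- The relation aba = b says that b inverts a, so b can be moved to the right past any power of a.
  have hb : SemiconjBy b a a⁻¹ := by
    rw [SemiconjBy, eq_inv_mul_iff_mul_eq, ← mul_assoc, h.aba]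
  induction hq using Subgroup.closure_induction_left with
  | one => exact ⟨0, 0, by simp⟩
  | mul_left x hx y _ ih =>
    obtain ⟨i, j, rfl⟩ := ih
    rcases hx with rfl | rfl
    · exact ⟨1 + i, j, by rw [zpow_add, zpow_one, mul_assoc]⟩
    · refine ⟨-i, 1 + j, ?_⟩
      rw [← mul_assoc, (hb.zpow_right i).eq, inv_zpow', zpow_add, zpow_one, mul_assoc]
  | inv_mul_cancel x hx y _ ih =>
    obtain ⟨i, j, rfl⟩ := ih
    rcases hx with rfl | rfl
    · exact ⟨-1 + i, j, by rw [zpow_add, zpow_neg_one, mul_assoc]⟩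
    · refine ⟨-i, -1 + j, ?_⟩
      have h1 := (hb.zpow_right (-i)).eq
      rw [inv_zpow', neg_neg] at h1
      rw [inv_mul_eq_iff_eq_mul, zpow_add, zpow_neg_one, ← mul_assoc, h1, mul_assoc,
        mul_inv_cancel_left]

/-- Every translation has the form `t ^ i * s ^ j`. -/
lemma exists_translation_eq {n : G}
    (hn : n ∈ Subgroup.closure {T * (a * a), MulAut.conj a (T * (a * a))}) :
    ∃ i j : ℤ, n = (T * (a * a)) ^ i * MulAut.conj a (T * (a * a)) ^ j := by
  have hc := h.commute
  generalize MulAut.conj a (T * (a * a)) = A at *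
  generalize T * (a * a) = t at *
  induction hn using Subgroup.closure_induction with
  | one => exact ⟨0, 0, by simp⟩
  | mem x hx =>
    rcases hx with rfl | rfl
    · exact ⟨1, 0, by simp⟩
    · exact ⟨0, 1, by simp⟩
  | mul x y _ _ ihx ihy =>
    obtain ⟨i, j, rfl⟩ := ihx
    obtain ⟨k, l, rfl⟩ := ihy
    refine ⟨i + k, j + l, ?_⟩
    rw [zpow_add, zpow_add, mul_assoc, ← mul_assoc (A ^ j), ← ((hc.zpow_zpow k j).eq)]
    simp only [mul_assoc]
  | inv x _ ih =>
    obtain ⟨i, j, rfl⟩ := ih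
    refine ⟨-i, -j, ?_⟩
    rw [zpow_neg, zpow_neg, mul_inv_rev, ((hc.zpow_zpow i j).inv_inv).eq]

lemma conj_mem {q n : G} (hq : q ∈ Subgroup.closure {a, b})
    (hn : n ∈ Subgroup.closure {T * (a * a), MulAut.conj a (T * (a * a))}) :
    MulAut.conj q n ∈ Subgroup.closure {T * (a * a), MulAut.conj a (T * (a * a))} := by
  set N := Subgroup.closure {T * (a * a), MulAut.conj a (T * (a * a))} with hN
  have ht : T * (a * a) ∈ N := Subgroup.subset_closure (by simp)
  have hs : MulAut.conj a (T * (a * a)) ∈ N := Subgroup.subset_closure (Or.inr rfl)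
  have ha : ∀ n ∈ N, MulAut.conj a n ∈ N := by
    change N ≤ N.comap (MulAut.conj a).toMonoidHom
    rw [hN, Subgroup.closure_le]
    rintro x (rfl | rfl)
    · exact hs
    · change MulAut.conj a (MulAut.conj a (T * (a * a))) ∈ N
      rw [h.conj_a_conj]
      exact inv_mem ht
  have hb : ∀ n ∈ N, MulAut.conj b n ∈ N := by
    change N ≤ N.comap (MulAut.conj b).toMonoidHom
    rw [hN, Subgroup.closure_le]
    rintro x (rfl | rfl)
    · change MulAut.conj b (T * (a * a)) ∈ N
      rw [h.conj_b_translation]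
      exact mul_mem (inv_mem ht) (inv_mem hs)
    · change MulAut.conj b (MulAut.conj a (T * (a * a))) ∈ N
      rw [h.conj_b_conj]
      exact mul_mem (inv_mem ht) hs
  have hab : ∀ x ∈ ({a, b} : Set G), ∀ n ∈ N, MulAut.conj x n ∈ N := by
    rintro x (rfl | rfl)
    exacts [ha, hb]
  induction hq using Subgroup.closure_induction_left with
  | one => simpa using hn
  | mul_left x hx y _ ih =>
    rw [map_mul MulAut.conj, MulAut.mul_apply]
    exact hab x hx _ ih
  | inv_mul_cancel x hx y _ ih =>
    -- `hab` covers conjugation by the generators only; since a and b have order dividing 4, their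
    -- inverses are positive powers.
    have : x⁻¹ = x * x * x := by
      rcases hx with rfl | rfl
      exacts [h.a_inv, h.b_inv]
    rw [this, map_mul, map_mul, map_mul]
    exact hab x hx _ (hab x hx _ (hab x hx _ ih))

/-- The stabilizer of `∞` is the product of its translations and the quaternion group. -/
lemma exists_eq_mul {g : G} (hg : g ∈ Subgroup.closure {a, b, T}) :
    ∃ n ∈ Subgroup.closure {T * (a * a), MulAut.conj a (T * (a * a))},
      ∃ q ∈ Subgroup.closure {a, b}, g = n * q := by
  set N := Subgroup.closure {T * (a * a), MulAut.conj a (T * (a * a))} with hN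
  set Q := Subgroup.closure {a, b} with hQ
  have haQ : a ∈ Q := Subgroup.subset_closure (by simp)
  have hbQ : b ∈ Q := Subgroup.subset_closure (by simp)
  induction hg using Subgroup.closure_induction with
  | one => exact ⟨1, one_mem _, 1, one_mem _, by simp⟩
  | mem x hx =>
    rcases hx with rfl | rfl | rfl
    · exact ⟨1, one_mem _, x, haQ, by simp⟩
    · exact ⟨1, one_mem _, x, hbQ, by simp⟩
    · exact ⟨x * (a * a), Subgroup.subset_closure (by simp), a * a, mul_mem haQ haQ, by
        rw [mul_assoc, h.sq_sq, mul_one]⟩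
  | mul x y _ _ ihx ihy =>
    obtain ⟨n, hn, q, hq, rfl⟩ := ihx
    obtain ⟨m, hm, r, hr, rfl⟩ := ihy
    exact ⟨n * MulAut.conj q m, mul_mem hn (h.conj_mem hq hm), q * r, mul_mem hq hr, by
      rw [MulAut.conj_apply]; group⟩
  | inv x _ ih =>
    obtain ⟨n, hn, q, hq, rfl⟩ := ih
    exact ⟨MulAut.conj q⁻¹ n⁻¹, h.conj_mem (inv_mem hq) (inv_mem hn), q⁻¹, inv_mem hq, by
      rw [MulAut.conj_apply]; group⟩

omit h in
lemma zpow_eq_of_cube {t : G} (ht : t ^ 3 = 1) (i : ℤ) :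
    t ^ i = 1 ∨ t ^ i = t ∨ t ^ i = t⁻¹ := by
  have h3 : t ^ (3 : ℤ) = 1 := by exact_mod_cast ht
  have key : ∀ k : ℤ, t ^ (3 * k) = 1 := fun k => by rw [zpow_mul, h3, one_zpow]
  obtain ⟨k, hk | hk | hk⟩ : ∃ k : ℤ, i = 3 * k ∨ i = 3 * k + 1 ∨ i = 3 * k + -1 :=
    -- Rounding to the nearest multiple of 3 leaves remainder 0, 1 or -1.
    ⟨(i + 1) / 3, by omega⟩
  · exact Or.inl (by rw [hk, key])
  · exact Or.inr (Or.inl (by rw [hk, zpow_add, key, one_mul, zpow_one]))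
  · exact Or.inr (Or.inr (by rw [hk, zpow_add, key, one_mul, zpow_neg_one]))

/-- The quaternion group acts transitively on the nontrivial translations. -/
lemma exists_conj_eq {n : G}
    (hn : n ∈ Subgroup.closure {T * (a * a), MulAut.conj a (T * (a * a))}) :
    n = 1 ∨ ∃ q ∈ Subgroup.closure {a, b}, n = MulAut.conj q (T * (a * a)) := by
  set Q := Subgroup.closure {a, b} with hQ
  have haQ : a ∈ Q := Subgroup.subset_closure (by simp)
  have hbQ : b ∈ Q := Subgroup.subset_closure (by simp)
  have hcube : MulAut.conj a (T * (a * a)) ^ 3 = 1 := by rw [← map_pow, h.cube, map_one]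
  obtain ⟨i, j, rfl⟩ := h.exists_translation_eq hn
  -- Apart from 1, the words tⁱ sʲ with t = T a² and s = a t a⁻¹ are eight, one for each element of
  -- Q: s, s⁻¹, t, ts, ts⁻¹, t⁻¹, t⁻¹s, t⁻¹s⁻¹ are the conjugates of t by a, a³, 1, b⁻¹, a²ba, a²,
  -- ba, b.
  rcases zpow_eq_of_cube h.cube i with hi | hi | hi <;>
    rcases zpow_eq_of_cube hcube j with hj | hj | hj <;> rw [hi, hj]
  · exact Or.inl (mul_one 1)
  · exact Or.inr ⟨a, haQ, one_mul _⟩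
  · refine Or.inr ⟨a * a * a, mul_mem (mul_mem haQ haQ) haQ, ?_⟩
    rw [map_mul MulAut.conj, MulAut.mul_apply, h.conj_sq_conj, one_mul]
  · exact Or.inr ⟨1, one_mem _, by simp⟩
  · refine Or.inr ⟨b⁻¹, inv_mem hbQ, ?_⟩
    rw [h.conj_b_inv_translation, h.commute.eq]
  · refine Or.inr ⟨a * a * (b * a), mul_mem (mul_mem haQ haQ) (mul_mem hbQ haQ), ?_⟩
    rw [map_mul MulAut.conj (a * a), MulAut.mul_apply, map_mul MulAut.conj b, MulAut.mul_apply,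
      h.conj_b_conj, map_mul _ (T * (a * a))⁻¹, h.conj_sq_conj, map_inv, h.conj_sq_translation,
      inv_inv]
  · refine Or.inr ⟨a * a, mul_mem haQ haQ, ?_⟩
    rw [h.conj_sq_translation, mul_one]
  · refine Or.inr ⟨b * a, mul_mem hbQ haQ, ?_⟩
    rw [map_mul MulAut.conj, MulAut.mul_apply, h.conj_b_conj]
  · exact Or.inr ⟨b, hbQ, h.conj_b_translation.symm⟩

end IsAffineTriple
end AffineTriple
-- Double coset decompositions from the relations involving J and U
section MathieuTuple

variable {G : Type*} [Group G]

/-- Elements `a`, `b`, `T`, `J` that satisfy the relations of `M(3²)`, where `b = [J, a]`. -/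
structure IsZassenhausTuple (a b T J : G) : Prop extends IsAffineTriple a b T where
  J_mul_J : J * J = 1
  conj_J_a : J * a * J = b * a
  conj_J_b : J * b * J = b⁻¹
  conj_J_T : J * T * J = T * J * T

namespace IsZassenhausTuple

variable {a b T J : G} (h : IsZassenhausTuple a b T J)
include h

lemma J_inv : J⁻¹ = J := inv_eq_of_mul_eq_one_left h.J_mul_J

lemma conj_J_mem {q : G} (hq : q ∈ Subgroup.closure {a, b}) :
    J * q * J ∈ Subgroup.closure {a, b} := by
  have haQ : a ∈ Subgroup.closure {a, b} := Subgroup.subset_closure (by simp)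
  have hbQ : b ∈ Subgroup.closure {a, b} := Subgroup.subset_closure (by simp)
  have key : Subgroup.closure {a, b} ≤
      (Subgroup.closure {a, b}).comap (MulAut.conj J).toMonoidHom := by
    rw [Subgroup.closure_le]
    rintro x (rfl | rfl)
    · change J * x * J⁻¹ ∈ Subgroup.closure _
      rw [h.J_inv, h.conj_J_a]
      exact mul_mem hbQ haQ
    · change J * x * J⁻¹ ∈ Subgroup.closure _
      rw [h.J_inv, h.conj_J_b]
      exact inv_mem hbQ
  have := key hq
  change J * q * J⁻¹ ∈ Subgroup.closure _ at this
  rwa [h.J_inv] at this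

/-- J commutes with a² = b² because it inverts b, so the braid relation JTJ = TJT carries over to T
a². This is the one computation needed to put JBJ inside B ∪ BJB. -/
lemma conj_J_translation : J * (T * (a * a)) * J = T * J * (T * (a * a)) := by
  have h1 : J * (a * a) * J = a * a := by
    calc J * (a * a) * J = J * (b * b) * J := by rw [h.sq_eq]
      _ = (J * b * J) * (J⁻¹ * J⁻¹) * (J * b * J) := by group
      _ = (b * b)⁻¹ := by rw [h.J_inv, h.J_mul_J, h.conj_J_b]; group
      _ = a * a := by rw [h.sq_eq, h.inv_sq]
  calc J * (T * (a * a)) * J = (J * T * J) * (J⁻¹ * J⁻¹) * (J * (a * a) * J) := by group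
    _ = _ := by rw [h.J_inv, h.J_mul_J, h.conj_J_T, h1]; group

/-- The Bruhat decomposition of `M(3²)` with respect to the stabilizer of `∞`. -/
lemma mem_or_exists_eq {g : G} (hg : g ∈ Subgroup.closure {a, b, T, J}) :
    g ∈ Subgroup.closure {a, b, T} ∨ ∃ x ∈ Subgroup.closure {a, b, T},
      ∃ y ∈ Subgroup.closure {a, b, T}, g = x * J * y := by
  set B := Subgroup.closure {a, b, T} with hB
  have haB : a ∈ B := Subgroup.subset_closure (by simp)
  have hbB : b ∈ B := Subgroup.subset_closure (by simp)
  have hTB : T ∈ B := Subgroup.subset_closure (by simp)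
  have hQB : Subgroup.closure {a, b} ≤ B := Subgroup.closure_mono (by
    rintro x (rfl | rfl) <;> simp)
  have htB : T * (a * a) ∈ B := mul_mem hTB (mul_mem haB haB)
  have hBmul : ∀ x ∈ B, ∀ g, (g ∈ B ∨ ∃ y ∈ B, ∃ z ∈ B, g = y * J * z) →
      (x * g ∈ B ∨ ∃ y ∈ B, ∃ z ∈ B, x * g = y * J * z) := by
    rintro x hx g (hg | ⟨y, hy, z, hz, rfl⟩)
    · exact Or.inl (mul_mem hx hg)
    · exact Or.inr ⟨x * y, mul_mem hx hy, z, hz, by group⟩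
  have hJmul : ∀ g, (g ∈ B ∨ ∃ y ∈ B, ∃ z ∈ B, g = y * J * z) →
      (J * g ∈ B ∨ ∃ y ∈ B, ∃ z ∈ B, J * g = y * J * z) := by
    rintro g (hg | ⟨y, hy, z, hz, rfl⟩)
    · exact Or.inr ⟨1, one_mem _, g, hg, by group⟩
    -- J normalizes Q, so only the translation n matters. If n ≠ 1 it is p (T a²) p⁻¹ with p in Q,
    -- and p can be carried across J, which leaves the single case `conj_J_translation`.
    obtain ⟨n, hn, q, hq, rfl⟩ := h.exists_eq_mul hy
    rcases h.exists_conj_eq hn with rfl | ⟨p, hp, rfl⟩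
    · refine Or.inl ?_
      rw [show J * (1 * q * J * z) = (J * q * J) * z by group]
      exact mul_mem (hQB (h.conj_J_mem hq)) hz
    · have hp' := hQB (h.conj_J_mem hp)
      have hq' := hQB (h.conj_J_mem hq)
      refine Or.inr ⟨J * p * J * T, mul_mem hp' hTB,
        T * (a * a) * ((J * p * J)⁻¹ * (J * q * J) * z),
        mul_mem htB (mul_mem (mul_mem (inv_mem hp') hq') hz), ?_⟩
      calc J * (MulAut.conj p (T * (a * a)) * q * J * z)
          = (J * p * J) * J⁻¹ * (T * (a * a)) * J * (J⁻¹ * (p⁻¹ * J⁻¹) * (J * q * J) * z) := by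
            rw [MulAut.conj_apply]; group
        _ = (J * p * J) * (J * (T * (a * a)) * J) * ((J * p * J)⁻¹ * (J * q * J) * z) := by
            simp only [mul_inv_rev, h.J_inv, mul_assoc]
        _ = _ := by rw [h.conj_J_translation]; group
  induction hg using Subgroup.closure_induction_left with
  | one => exact Or.inl (one_mem _)
  | mul_left x hx y _ ih =>
    rcases hx with rfl | rfl | rfl | rfl
    exacts [hBmul _ haB _ ih, hBmul _ hbB _ ih, hBmul _ hTB _ ih, hJmul _ ih]
  | inv_mul_cancel x hx y _ ih =>
    rcases hx with rfl | rfl | rfl | rfl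
    · exact hBmul _ (inv_mem haB) _ ih
    · exact hBmul _ (inv_mem hbB) _ ih
    · exact hBmul _ (inv_mem hTB) _ ih
    · rw [h.J_inv]
      exact hJmul _ ih

end IsZassenhausTuple

/-- Elements `a`, `b`, `T`, `J`, `U` that satisfy the relations of `M₁₁`, where `b = [J, a]`. -/
structure IsMathieuTuple (a b T J U : G) : Prop extends IsZassenhausTuple a b T J where
  U_mul_U : U * U = 1
  conj_U_a : U * a * U = b
  conj_U_T : U * T * U = T
  conj_U_J : U * J * U = J * U * J

namespace IsMathieuTuple

variable {a b T J U : G} (h : IsMathieuTuple a b T J U)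
include h

lemma U_inv : U⁻¹ = U := inv_eq_of_mul_eq_one_left h.U_mul_U

lemma conj_U_mem {x : G} (hx : x ∈ Subgroup.closure {a, b, T}) :
    U * x * U ∈ Subgroup.closure {a, b, T} := by
  have key : Subgroup.closure {a, b, T} ≤
      (Subgroup.closure {a, b, T}).comap (MulAut.conj U).toMonoidHom := by
    rw [Subgroup.closure_le]
    rintro x (rfl | rfl | rfl)
    · change U * x * U⁻¹ ∈ Subgroup.closure _
      rw [h.U_inv, h.conj_U_a]
      exact Subgroup.subset_closure (by simp)
    · change U * x * U⁻¹ ∈ Subgroup.closure _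
      rw [← h.conj_U_a, show U * (U * a * U) * U⁻¹ = (U * U) * a by group, h.U_mul_U, one_mul]
      exact Subgroup.subset_closure (by simp)
    · change U * x * U⁻¹ ∈ Subgroup.closure _
      rw [h.U_inv, h.conj_U_T]
      exact Subgroup.subset_closure (by simp)
  have := key hx
  change U * x * U⁻¹ ∈ Subgroup.closure _ at this
  rwa [h.U_inv] at this

/-- The decomposition of `M₁₁` into double cosets of `M(3²)`. -/
lemma mem_or_exists_eq_mul {g : G} (hg : g ∈ Subgroup.closure {a, b, T, J, U}) :
    g ∈ Subgroup.closure {a, b, T, J} ∨ ∃ x ∈ Subgroup.closure {a, b, T, J},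
      ∃ y ∈ Subgroup.closure {a, b, T, J}, g = x * U * y := by
  set H := Subgroup.closure {a, b, T, J} with hH
  have haH : a ∈ H := Subgroup.subset_closure (by simp)
  have hbH : b ∈ H := Subgroup.subset_closure (by simp)
  have hTH : T ∈ H := Subgroup.subset_closure (by simp)
  have hJH : J ∈ H := Subgroup.subset_closure (by simp)
  have hBH : Subgroup.closure {a, b, T} ≤ H := Subgroup.closure_mono (by
    rintro x (rfl | rfl | rfl) <;> simp)
  have hHmul : ∀ x ∈ H, ∀ g, (g ∈ H ∨ ∃ y ∈ H, ∃ z ∈ H, g = y * U * z) →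
      (x * g ∈ H ∨ ∃ y ∈ H, ∃ z ∈ H, x * g = y * U * z) := by
    rintro x hx g (hg | ⟨y, hy, z, hz, rfl⟩)
    · exact Or.inl (mul_mem hx hg)
    · exact Or.inr ⟨x * y, mul_mem hx hy, z, hz, by group⟩
  have hUmul : ∀ g, (g ∈ H ∨ ∃ y ∈ H, ∃ z ∈ H, g = y * U * z) →
      (U * g ∈ H ∨ ∃ y ∈ H, ∃ z ∈ H, U * g = y * U * z) := by
    rintro g (hg | ⟨y, hy, z, hz, rfl⟩)
    · exact Or.inr ⟨1, one_mem _, g, hg, by group⟩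
    -- U normalizes B, which settles y in B. For y in BJB it reduces UyU to UJU, and UJU = JUJ lies
    -- in HUH.
    rcases h.mem_or_exists_eq hy with hy' | ⟨x₁, hx₁, x₂, hx₂, rfl⟩
    · refine Or.inl ?_
      rw [show U * (y * U * z) = U * y * U * z by group]
      exact mul_mem (hBH (h.conj_U_mem hy')) hz
    · refine Or.inr ⟨U * x₁ * U * J, mul_mem (hBH (h.conj_U_mem hx₁)) hJH,
        J * (U * x₂ * U) * z, mul_mem (mul_mem hJH (hBH (h.conj_U_mem hx₂))) hz, ?_⟩
      calc U * (x₁ * J * x₂ * U * z)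
          = (U * x₁ * U) * (U⁻¹ * J * U⁻¹) * (U * x₂ * U) * z := by group
        _ = (U * x₁ * U) * (J * U * J) * (U * x₂ * U) * z := by rw [h.U_inv, h.conj_U_J]
        _ = _ := by group
  induction hg using Subgroup.closure_induction_left with
  | one => exact Or.inl (one_mem _)
  | mul_left x hx y _ ih =>
    rcases hx with rfl | rfl | rfl | rfl | rfl
    exacts [hHmul _ haH _ ih, hHmul _ hbH _ ih, hHmul _ hTH _ ih, hHmul _ hJH _ ih, hUmul _ ih]
  | inv_mul_cancel x hx y _ ih =>
    rcases hx with rfl | rfl | rfl | rfl | rfl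
    · exact hHmul _ (inv_mem haH) _ ih
    · exact hHmul _ (inv_mem hbH) _ ih
    · exact hHmul _ (inv_mem hTH) _ ih
    · exact hHmul _ (inv_mem hJH) _ ih
    · rw [h.U_inv]
      exact hUmul _ ih

end IsMathieuTuple
end MathieuTuple

/-! ### From the relators to the working form of the relations -/

section Presentation

lemma isMathieuTuple_of_lift {G : Type*} [Group G] (f : FreeGroup Gen →* G)
    (rel : ∀ r ∈ rels, f r = 1) {b : G}
    (hB : f (FreeGroup.of .J) * f (FreeGroup.of .a) * (f (FreeGroup.of .J))⁻¹ *
      (f (FreeGroup.of .a))⁻¹ = b) :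
    IsMathieuTuple (f (FreeGroup.of .a)) b (f (FreeGroup.of .T)) (f (FreeGroup.of .J))
      (f (FreeGroup.of .U)) := by
  simp only [rels, Set.mem_union, Set.mem_insert_iff, Set.mem_singleton_iff, or_imp, forall_and,
    forall_eq, comm, conjBy, map_mul, map_pow, map_inv] at rel
  obtain ⟨⟨hT, hJ, hJT, hTa, hb4, hJb, hab, hconj⟩, hU, hUT, hUJ, hUa⟩ := rel
  rw [hB] at hb4 hJb hab hconj hUa
  generalize f (FreeGroup.of Gen.a) = a at *
  generalize f (FreeGroup.of Gen.T) = T at *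
  generalize f (FreeGroup.of Gen.J) = J at *
  generalize f (FreeGroup.of Gen.U) = U at *
  have hT' : T * T = 1 := by rw [← hT, pow_two]
  have hJ' : J * J = 1 := by rw [← hJ, pow_two]
  have hU' : U * U = 1 := by rw [← hU, pow_two]
  have iT : T⁻¹ = T := inv_eq_of_mul_eq_one_left hT'
  have iJ : J⁻¹ = J := inv_eq_of_mul_eq_one_left hJ'
  have iU : U⁻¹ = U := inv_eq_of_mul_eq_one_left hU'
  have hsq : b * b = a * a := by
    rw [← pow_two, ← pow_two]
    exact (mul_inv_eq_one.1 hab).symm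
  have hb2 : b * b * (b * b) = 1 := by rw [← hb4]; simp only [pow_succ, pow_zero, one_mul, mul_assoc]
  have ib2 : b⁻¹ * b⁻¹ = b * b := by
    rw [← mul_inv_rev]
    exact inv_eq_of_mul_eq_one_left hb2
  have hJa : J * a * J = b * a := by
    rw [← hB, iJ]
    group
  have hJbJ : J * b * J = b⁻¹ := by
    rw [eq_inv_iff_mul_eq_one, ← hJb]
    simp only [pow_succ, pow_zero, one_mul, mul_assoc]
  -- Conjugating a² = b² by J: the left side becomes (ba)², the right side b⁻² = b². Cancelling b
  -- then gives aba = b.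
  have hbaba : b * a * (b * a) = b * b := by
    calc b * a * (b * a) = J * a * (J * J) * a * J := by rw [← hJa]; group
      _ = J * (a * a) * J := by rw [hJ']; group
      _ = J * b * (J * J) * b * J := by rw [← hsq, hJ']; group
      _ = (J * b * J) * (J * b * J) := by group
      _ = b * b := by rw [hJbJ, ib2]
  -- For self-inverse elements, (xy)³ = 1 is the braid relation.
  have brel : ∀ x y : G, x⁻¹ = x → y⁻¹ = y → (x * y) ^ 3 = 1 →
      x * y * x = y * x * y := by
    intro x y hx hy hxy
    have h1 : x * y * x * (y * x * y) = 1 := by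
      rw [← hxy]
      simp only [pow_succ, pow_zero, one_mul, mul_assoc]
    rw [eq_inv_of_mul_eq_one_left h1, mul_inv_rev, mul_inv_rev, hx, hy, mul_assoc]
  refine
    { sq_eq := hsq
      sq_sq := by rw [← hsq, hb2]
      aba := ?_
      T_mul_T := hT'
      cube := by rw [← hTa, pow_two]
      conj_T := by
        rw [← pow_two]
        exact mul_inv_eq_one.1 hconj
      J_mul_J := hJ'
      conj_J_a := hJa
      conj_J_b := hJbJ
      conj_J_T := brel J T iJ iT hJT
      U_mul_U := hU'
      conj_U_a := by
        have := mul_inv_eq_one.1 hUa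
        rwa [iU] at this
      conj_U_T := ?_
      conj_U_J := brel U J iU iJ hUJ }
  · apply mul_left_cancel (a := b)
    rw [← hbaba]
    group
  · rw [← iT, eq_inv_iff_mul_eq_one, iT, ← hUT]
    simp only [pow_succ, pow_zero, one_mul, mul_assoc]

/-- The image of a generating symbol in the presented group. -/
abbrev gen (x : Gen) : PresentedGroup rels := PresentedGroup.of x

/-- The element `[J, a]` of the presented group. -/
abbrev genB : PresentedGroup rels := comm (gen .J) (gen .a)

lemma isMathieuTuple : IsMathieuTuple (gen .a) genB (gen .T) (gen .J) (gen .U) :=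
  isMathieuTuple_of_lift (PresentedGroup.mk rels) (fun _ hr => PresentedGroup.one_of_mem hr) rfl

end Presentation
-- Faithfulness along the chain of stabilizers of v, ∞, 0, 1
section Faithful

/-- The permutation that `[J, a]` induces on the coordinate points. -/
def bPerm : Equiv.Perm Pt := comm jPerm aPerm

lemma act_genB : act genB = bPerm := by
  simp only [genB, comm, map_mul, map_inv, act_of, bPerm, genPerm]

/-- The stabilizer in the presented group of a coordinate point. -/
def stab (p : Pt) : Subgroup (PresentedGroup rels) := (MulAction.stabilizer _ p).comap act

lemma mem_stab {p : Pt} {g : PresentedGroup rels} : g ∈ stab p ↔ act g p = p := Iff.rfl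

/-- The elements `a`, `[J, a]`, `T`, `J` generate the part of the group that fixes `v`. -/
abbrev genM9 : Subgroup (PresentedGroup rels) := Subgroup.closure {gen .a, genB, gen .T, gen .J}

/-- The elements `a`, `[J, a]`, `T` generate the part of the group that fixes `v` and `∞`. -/
abbrev genAffine : Subgroup (PresentedGroup rels) := Subgroup.closure {gen .a, genB, gen .T}

/-- The elements `a`, `[J, a]` generate the part of the group that fixes `v`, `∞` and `0`. -/
abbrev genQuaternion : Subgroup (PresentedGroup rels) := Subgroup.closure {gen .a, genB}

lemma genM9_le_stab : genM9 ≤ stab none := by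
  rw [Subgroup.closure_le]
  rintro x (rfl | rfl | rfl | rfl) <;>
    simp only [SetLike.mem_coe, mem_stab, act_of, act_genB, genPerm] <;> decide +kernel

lemma genAffine_le_stab : genAffine ≤ stab (some none) := by
  rw [Subgroup.closure_le]
  rintro x (rfl | rfl | rfl) <;>
    simp only [SetLike.mem_coe, mem_stab, act_of, act_genB, genPerm] <;> decide +kernel

lemma genQuaternion_le_stab : genQuaternion ≤ stab (some (some 0)) := by
  rw [Subgroup.closure_le]
  rintro x (rfl | rfl) <;>
    simp only [SetLike.mem_coe, mem_stab, act_of, act_genB, genPerm] <;> decide +kernel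

lemma closure_gen_eq_top :
    Subgroup.closure {gen .a, genB, gen .T, gen .J, gen .U} = ⊤ := by
  rw [eq_top_iff, ← PresentedGroup.closure_range_of, Subgroup.closure_le]
  rintro _ ⟨x, rfl⟩
  cases x <;> exact Subgroup.subset_closure (by simp)

/-- An element x U y of the other double coset moves v, since x and y fix v and U does not. -/
lemma mem_genM9_of_act {g : PresentedGroup rels} (hg : act g none = none) : g ∈ genM9 := by
  have hmem : g ∈ Subgroup.closure {gen .a, genB, gen .T, gen .J, gen .U} := by
    rw [closure_gen_eq_top]
    trivial
  rcases isMathieuTuple.mem_or_exists_eq_mul hmem with h | ⟨x, hx, y, hy, rfl⟩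
  · exact h
  · exfalso
    have h1 : act y none = none := genM9_le_stab hy
    have h2 : act x none = none := genM9_le_stab hx
    rw [map_mul, map_mul, Equiv.Perm.mul_apply, Equiv.Perm.mul_apply, h1] at hg
    have h3 := (act x).injective (hg.trans h2.symm)
    rw [act_of] at h3
    exact absurd h3 (by decide +kernel)

lemma mem_genAffine_of_act {g : PresentedGroup rels} (hg : g ∈ genM9)
    (h : act g (some none) = some none) : g ∈ genAffine := by
  rcases isMathieuTuple.mem_or_exists_eq hg with h' | ⟨x, hx, y, hy, rfl⟩
  · exact h'
  · exfalso
    have h1 : act y (some none) = some none := genAffine_le_stab hy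
    have h2 : act x (some none) = some none := genAffine_le_stab hx
    rw [map_mul, map_mul, Equiv.Perm.mul_apply, Equiv.Perm.mul_apply, h1] at h
    have h3 := (act x).injective (h.trans h2.symm)
    rw [act_of] at h3
    exact absurd h3 (by decide +kernel)

/-- A nontrivial translation is a conjugate of T a² by an element of Q. Such an element fixes 0,
whereas T a² moves 0. -/
lemma mem_genQuaternion_of_act {g : PresentedGroup rels} (hg : g ∈ genAffine)
    (h : act g (some (some 0)) = some (some 0)) : g ∈ genQuaternion := by
  have hM := isMathieuTuple
  obtain ⟨n, hn, q, hq, rfl⟩ := hM.exists_eq_mul hg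
  have h1 : act q (some (some 0)) = some (some 0) := genQuaternion_le_stab hq
  rw [map_mul, Equiv.Perm.mul_apply, h1] at h
  rcases hM.exists_conj_eq hn with rfl | ⟨p, hp, rfl⟩
  · rwa [one_mul]
  · exfalso
    have h2 : act p⁻¹ (some (some 0)) = some (some 0) := genQuaternion_le_stab (inv_mem hp)
    have h3 : act p (some (some 0)) = some (some 0) := genQuaternion_le_stab hp
    rw [MulAut.conj_apply, map_mul, map_mul act p, Equiv.Perm.mul_apply, Equiv.Perm.mul_apply,
      h2] at h
    have h4 := (act p).injective (h.trans h3.symm)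
    rw [map_mul, map_mul, act_of, act_of] at h4
    exact absurd h4 (by decide +kernel)

lemma zpow_eq_of_fourth {G : Type*} [Group G] {t : G} (ht : t ^ 4 = 1) (i : ℤ) :
    t ^ i = 1 ∨ t ^ i = t ∨ t ^ i = t * t ∨ t ^ i = t * t * t := by
  have h4 : t ^ (4 : ℤ) = 1 := by exact_mod_cast ht
  have key : ∀ k : ℤ, t ^ (4 * k) = 1 := fun k => by rw [zpow_mul, h4, one_zpow]
  obtain ⟨k, hk | hk | hk | hk⟩ : ∃ k : ℤ, i = 4 * k ∨ i = 4 * k + 1 ∨ i = 4 * k + (1 + 1) ∨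
      i = 4 * k + (1 + 1 + 1) := ⟨i / 4, by omega⟩
  all_goals rw [hk]; simp only [zpow_add, key, one_mul, zpow_one, true_or, or_true]

lemma eq_one_of_act {g : PresentedGroup rels} (hg : g ∈ genQuaternion)
    (h : act g (some (some (1, 0))) = some (some (1, 0))) : g = 1 := by
  have hM := isMathieuTuple
  obtain ⟨i, j, rfl⟩ := hM.exists_zpow_mul_zpow hg
  have ha : gen .a ^ 4 = 1 := by
    rw [← hM.sq_sq]
    simp only [pow_succ, pow_zero, one_mul, mul_assoc]
  have hb : genB ^ 4 = 1 := by
    rw [← hM.sq_sq, ← hM.sq_eq]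
    simp only [pow_succ, pow_zero, one_mul, mul_assoc]
  rw [map_mul] at h
  rcases zpow_eq_of_fourth ha i with hi | hi | hi | hi <;>
    rcases zpow_eq_of_fourth hb j with hj | hj | hj | hj <;> rw [hi, hj] at h ⊢ <;>
    simp only [map_mul, map_one, act_of, act_genB, genPerm] at h
  case inl.inl => exact one_mul 1
  -- The sixteen words cover the quaternion group twice, so a²b² is a second expression for 1; the
  -- other fourteen words move the point 1.
  case inr.inr.inl.inr.inr.inl => rw [hM.sq_eq, hM.sq_sq]
  all_goals exact absurd h (by decide +kernel)

lemma act_injective : Function.Injective act := by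
  rw [injective_iff_map_eq_one]
  intro g hg
  have h : ∀ p, act g p = p := fun p => by rw [hg, Equiv.Perm.one_apply]
  exact eq_one_of_act (mem_genQuaternion_of_act
    (mem_genAffine_of_act (mem_genM9_of_act (h _)) (h _)) (h _)) (h _)

end Faithful

/-! ### Triple transitivity on the projective line -/

section Transitive

lemma gen_a_mem : gen .a ∈ genQuaternion := Subgroup.subset_closure (by simp)

lemma genB_mem : genB ∈ genQuaternion := Subgroup.subset_closure (by simp)

lemma genQuaternion_le : genQuaternion ≤ genAffine :=
  Subgroup.closure_mono (by rintro x (rfl | rfl) <;> simp)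

lemma genAffine_le : genAffine ≤ genM9 :=
  Subgroup.closure_mono (by rintro x (rfl | rfl | rfl) <;> simp)

lemma exists_act_eq_one {p : ZMod 3 × ZMod 3} (hp : p ≠ 0) :
    ∃ g ∈ genQuaternion, act g (some (some p)) = some (some (1, 0)) := by
  have h : ∀ p : ZMod 3 × ZMod 3, p ≠ 0 → ∃ i : Fin 4, ∃ j : Fin 2,
      (aPerm ^ (i : ℕ) * bPerm ^ (j : ℕ)) (some (some p)) = some (some (1, 0)) := by
    decide +kernel
  obtain ⟨i, j, hij⟩ := h p hp
  refine ⟨gen .a ^ (i : ℕ) * genB ^ (j : ℕ),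
    mul_mem (pow_mem gen_a_mem _) (pow_mem genB_mem _), ?_⟩
  rw [map_mul, map_pow, map_pow, act_of, act_genB]
  exact hij

lemma exists_act_eq_zero (p : ZMod 3 × ZMod 3) :
    ∃ g ∈ genAffine, act g (some (some p)) = some (some 0) := by
  -- A nonzero p is first moved to 1 by Q, and T interchanges 1 and 0; for p = 0 no move is needed.
  have h : ∀ p : ZMod 3 × ZMod 3, ∃ i : Fin 4, ∃ j : Fin 2, ∃ k : Fin 2,
      (tPerm ^ (k : ℕ) * (aPerm ^ (i : ℕ) * bPerm ^ (j : ℕ))) (some (some p)) = some (some 0) := by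
    decide +kernel
  obtain ⟨i, j, k, hij⟩ := h p
  have hT : gen .T ∈ genAffine := Subgroup.subset_closure (by simp)
  refine ⟨gen .T ^ (k : ℕ) * (gen .a ^ (i : ℕ) * genB ^ (j : ℕ)), mul_mem (pow_mem hT _)
    (genQuaternion_le (mul_mem (pow_mem gen_a_mem _) (pow_mem genB_mem _))), ?_⟩
  rw [map_mul, map_mul, map_pow, map_pow, map_pow, act_of, act_of, act_genB]
  exact hij

lemma exists_act_eq_infty (p : Option (ZMod 3 × ZMod 3)) :
    ∃ g ∈ genM9, act g (some p) = some none := by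
  cases p with
  | none => exact ⟨1, one_mem _, by simp⟩
  | some p =>
    obtain ⟨g, hg, h⟩ := exists_act_eq_zero p
    refine ⟨gen .J * g, mul_mem (Subgroup.subset_closure (by simp)) (genAffine_le hg), ?_⟩
    rw [map_mul, Equiv.Perm.mul_apply, h, act_of]
    decide +kernel

/-- The subgroup `⟨a, T, J⟩` acts triply transitively on the points other than `v`. -/
lemma exists_act_eq {p q r : Option (ZMod 3 × ZMod 3)} (hpq : p ≠ q) (hpr : p ≠ r) (hqr : q ≠ r) :
    ∃ g ∈ genM9, act g (some p) = some none ∧ act g (some q) = some (some 0) ∧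
      act g (some r) = some (some (1, 0)) := by
  obtain ⟨g₁, hg₁, h₁⟩ := exists_act_eq_infty p
  have hsome : ∀ s, p ≠ s → ∃ s' : ZMod 3 × ZMod 3, act g₁ (some s) = some (some s') := by
    intro s hs
    have hv : act g₁ none = none := genM9_le_stab hg₁
    rcases h : act g₁ (some s) with _ | _ | s'
    · exact absurd ((act g₁).injective (h.trans hv.symm)) (by simp)
    · exact absurd (Option.some_injective _ ((act g₁).injective (h₁.trans h.symm))) hs
    · exact ⟨s', rfl⟩
  obtain ⟨q', hq'⟩ := hsome q hpq
  obtain ⟨r', hr'⟩ := hsome r hpr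
  obtain ⟨g₂, hg₂, h₂⟩ := exists_act_eq_zero q'
  have h₂i : act g₂ (some none) = some none := genAffine_le_stab hg₂
  obtain ⟨r'', hr''⟩ : ∃ r'', act g₂ (some (some r')) = some (some r'') := by
    have hv : act g₂ none = none := genM9_le_stab (genAffine_le hg₂)
    rcases h : act g₂ (some (some r')) with _ | _ | s
    · exact absurd ((act g₂).injective (h.trans hv.symm)) (by simp)
    · exact absurd ((act g₂).injective (h.trans h₂i.symm)) (by simp)
    · exact ⟨s, rfl⟩
  have hr0 : r'' ≠ 0 := by
    rintro rfl
    have h := (act g₂).injective (h₂.trans hr''.symm)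
    rw [← hq', ← hr'] at h
    exact hqr (Option.some_injective _ ((act g₁).injective h))
  obtain ⟨g₃, hg₃, h₃⟩ := exists_act_eq_one hr0
  have h₃i : act g₃ (some none) = some none := genAffine_le_stab (genQuaternion_le hg₃)
  have h₃0 : act g₃ (some (some 0)) = some (some 0) := genQuaternion_le_stab hg₃
  refine ⟨g₃ * g₂ * g₁, mul_mem (mul_mem (genAffine_le (genQuaternion_le hg₃))
    (genAffine_le hg₂)) hg₁, ?_, ?_, ?_⟩ <;>
    simp only [map_mul, Equiv.Perm.mul_apply, h₁, hq', hr', h₂i, h₂, hr'', h₃i, h₃0, h₃]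

end Transitive
-- Comparing coordinates with the field
section Coordinates

lemma card_K : Nat.card K = 9 := by
  have := GaloisField.card 3 2 (by norm_num)
  norm_num at this
  exact this

lemma three_eq_zero : (3 : K) = 0 := by exact_mod_cast CharP.cast_eq_zero K 3

lemma algebraMap_pow_three (x : ZMod 3) : algebraMap (ZMod 3) K x ^ 3 = algebraMap (ZMod 3) K x := by
  rw [← map_pow, ZMod.pow_card]

variable (ζ : K) (hζ : ζ ^ 2 = 1 - ζ)

include hζ in
lemma zeta_ne_zero : ζ ≠ 0 := by
  rintro rfl
  norm_num at hζ

lemma coord_apply (p : ZMod 3 × ZMod 3) :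
    coord ζ hζ p = algebraMap (ZMod 3) K p.1 + ζ * algebraMap (ZMod 3) K p.2 := rfl

lemma coord_zero : coord ζ hζ 0 = 0 := by simp [coord_apply]

lemma coord_one : coord ζ hζ (1, 0) = 1 := by simp [coord_apply]

lemma coord_eq_zero_iff {p : ZMod 3 × ZMod 3} : coord ζ hζ p = 0 ↔ p = 0 := by
  rw [← coord_zero ζ hζ, EmbeddingLike.apply_eq_iff_eq]

/-- Cubing is additive in characteristic 3 and fixes the prime field, and ζ³ = ζ - ζ² = 2ζ - 1. -/
lemma inv_mul_coord_pow_three (p : ZMod 3 × ZMod 3) :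
    ζ⁻¹ * coord ζ hζ p ^ 3 = coord ζ hζ (p.1 + p.2, p.1 - p.2) := by
  rw [inv_mul_eq_iff_eq_mul₀ (zeta_ne_zero ζ hζ)]
  simp only [coord_apply, map_add, map_sub]
  have h1 := algebraMap_pow_three p.1
  have h2 := algebraMap_pow_three p.2
  have h3 := three_eq_zero
  generalize algebraMap (ZMod 3) K p.1 = X at *
  generalize algebraMap (ZMod 3) K p.2 = Y at *
  linear_combination h1 + ζ ^ 3 * h2 + (X ^ 2 * ζ * Y + X * ζ ^ 2 * Y ^ 2) * h3 +
    (ζ * Y - X) * hζ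

lemma one_sub_coord (p : ZMod 3 × ZMod 3) :
    1 - coord ζ hζ p = coord ζ hζ (1 - p.1, -p.2) := by
  simp only [coord_apply, map_neg, map_sub, map_one]
  ring

/-- The conjugate of X + ζY is (X - Y) - ζY, with norm n = X² - XY - Y². For a nonzero element n =
±1, so dividing the conjugate by n is multiplying it by n. -/
lemma coord_inv {p : ZMod 3 × ZMod 3} (hp : p ≠ 0) :
    (coord ζ hζ p)⁻¹ = coord ζ hζ ((p.1 - p.2) * (p.1 ^ 2 - p.1 * p.2 - p.2 ^ 2),
      -p.2 * (p.1 ^ 2 - p.1 * p.2 - p.2 ^ 2)) := by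
  have hN : ∀ p : ZMod 3 × ZMod 3, p ≠ 0 → (p.1 ^ 2 - p.1 * p.2 - p.2 ^ 2) ^ 2 = 1 := by decide
  have h := congrArg (algebraMap (ZMod 3) K) (hN p hp)
  apply inv_eq_of_mul_eq_one_right
  simp only [coord_apply, map_neg, map_sub, map_mul, map_pow, map_one] at h ⊢
  generalize algebraMap (ZMod 3) K p.1 = X at *
  generalize algebraMap (ZMod 3) K p.2 = Y at *
  linear_combination h - Y ^ 2 * (X ^ 2 - X * Y - Y ^ 2) * hζ

/-- The eleven points in coordinates. -/
noncomputable def pointEquiv : Pt ≃ Points := Equiv.optionCongr (Equiv.optionCongr (coord ζ hζ))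

lemma pointEquiv_infty : pointEquiv ζ hζ (some none) = some OnePoint.infty := rfl

lemma pointEquiv_some (p : ZMod 3 × ZMod 3) :
    pointEquiv ζ hζ (some (some p)) = some (OnePoint.some (coord ζ hζ p)) := rfl

lemma aMap_pointEquiv (p : Pt) : aMap ζ (pointEquiv ζ hζ p) = pointEquiv ζ hζ (aPerm p) := by
  rcases p with _ | _ | p
  · rfl
  · rfl
  · exact congrArg (fun y : K => (some (OnePoint.some y) : Points))
      (inv_mul_coord_pow_three ζ hζ p)

lemma tMap_pointEquiv (p : Pt) : tMap (pointEquiv ζ hζ p) = pointEquiv ζ hζ (tPerm p) := by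
  rcases p with _ | _ | p
  · rfl
  · rfl
  · exact congrArg (fun y : K => (some (OnePoint.some y) : Points)) (one_sub_coord ζ hζ p)

open scoped Classical in
lemma jMap_pointEquiv (p : Pt) : jMap (pointEquiv ζ hζ p) = pointEquiv ζ hζ (jPerm p) := by
  rcases p with _ | _ | p
  · rfl
  · exact congrArg (fun y : K => (some (OnePoint.some y) : Points)) (coord_zero ζ hζ).symm
  · change (if coord ζ hζ p = 0 then some OnePoint.infty else
      some (OnePoint.some (coord ζ hζ p)⁻¹) : Points) = pointEquiv ζ hζ (jFun (some (some p)))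
    by_cases hp : p = 0
    · rw [if_pos ((coord_eq_zero_iff ζ hζ).2 hp), jFun, if_pos hp, pointEquiv_infty]
    · rw [if_neg (mt (coord_eq_zero_iff ζ hζ).1 hp), jFun, if_neg hp, pointEquiv_some,
        coord_inv ζ hζ hp]

lemma S4_pointEquiv (p : Pt) : S4 ζ hζ (pointEquiv ζ hζ p) = pointEquiv ζ hζ (uPerm p) := by
  rcases p with _ | _ | p
  · rfl
  · rfl
  · refine congrArg (fun y : K => (some (OnePoint.some y) : Points)) ?_
    simp [reflect]

/-- The action of the presented group on the eleven points. -/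
noncomputable def action : PresentedGroup rels →* Equiv.Perm Points :=
  (pointEquiv ζ hζ).permCongrHom.toMonoidHom.comp act

lemma action_pointEquiv (g : PresentedGroup rels) (p : Pt) :
    action ζ hζ g (pointEquiv ζ hζ p) = pointEquiv ζ hζ (act g p) := by
  simp [action, Equiv.permCongr_apply]

lemma action_injective : Function.Injective (action ζ hζ) :=
  (pointEquiv ζ hζ).permCongrHom.injective.comp act_injective

lemma action_of_eq {f : Points → Points} {x : Gen}
    (h : ∀ p, f (pointEquiv ζ hζ p) = pointEquiv ζ hζ (genPerm x p)) (ω : Points) :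
    action ζ hζ (gen x) ω = f ω := by
  obtain ⟨p, rfl⟩ := (pointEquiv ζ hζ).surjective ω
  rw [action_pointEquiv, act_of, h]

lemma action_a (ω : Points) : action ζ hζ (gen .a) ω = aMap ζ ω :=
  action_of_eq ζ hζ (aMap_pointEquiv ζ hζ) ω

lemma action_T (ω : Points) : action ζ hζ (gen .T) ω = tMap ω :=
  action_of_eq ζ hζ (tMap_pointEquiv ζ hζ) ω

lemma action_J (ω : Points) : action ζ hζ (gen .J) ω = jMap ω :=
  action_of_eq ζ hζ (jMap_pointEquiv ζ hζ) ω

lemma action_U : action ζ hζ (gen .U) = S4 ζ hζ :=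
  Equiv.ext (action_of_eq ζ hζ (S4_pointEquiv ζ hζ))

end Coordinates

/-! ### Identifying the image of ⟨a, T, J⟩ with M(3²) -/

section Zassenhaus

/-- The extension of permutations of the projective line to the eleven points. -/
def extendHom : Equiv.Perm Line →* Equiv.Perm Points :=
  MonoidHom.mk' Equiv.optionCongr fun g h => Equiv.optionCongr_trans h g

lemma extendHom_some (h : Equiv.Perm Line) (ω : Line) : extendHom h (some ω) = some (h ω) := rfl

lemma extendHom_none (h : Equiv.Perm Line) : extendHom h none = none := rfl

open scoped Classical in
lemma mem_map_M9 {g : Equiv.Perm Points} (A : GL (Fin 2) K) (h0 : g none = none)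
    (h : ∀ ω : Line, g (some ω) = some (A • twist A ω)) : g ∈ M9.map extendHom := by
  have hr : ∀ ω : Line, Equiv.removeNone g ω = A • twist A ω := by
    intro ω
    apply Option.some_injective
    rw [← h ω]
    exact Equiv.removeNone_some g ⟨_, h ω⟩
  refine ⟨Equiv.removeNone g, ⟨A, hr⟩, ?_⟩
  ext1 ω
  rcases ω with _ | ω
  · rw [extendHom_none, h0]
  · rw [extendHom_some, hr, h]

open scoped Classical in
lemma twist_of_isSquare {A : GL (Fin 2) K} (h : IsSquare (Matrix.GeneralLinearGroup.det A))
    (ω : Line) : twist A ω = ω := if_pos h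

open scoped Classical in
/-- A transformation in `M(3²)` that fixes `∞`, `0` and `1` is trivial. -/
lemma eq_one_of_mem_M9 {h : Equiv.Perm Line} (hh : h ∈ M9)
    (hi : h OnePoint.infty = OnePoint.infty) (h0 : h (OnePoint.some 0) = OnePoint.some 0)
    (h1 : h (OnePoint.some 1) = OnePoint.some 1) : h = 1 := by
  obtain ⟨A, hA⟩ := hh
  have ti : twist A OnePoint.infty = OnePoint.infty := by
    unfold twist
    split_ifs <;> rfl
  have t0 : twist A (OnePoint.some 0) = OnePoint.some 0 := by
    unfold twist
    split_ifs
    · rfl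
    · exact congrArg OnePoint.some (map_zero conj)
  have t1 : twist A (OnePoint.some 1) = OnePoint.some 1 := by
    unfold twist
    split_ifs
    · rfl
    · exact congrArg OnePoint.some (map_one conj)
  rw [hA, ti, OnePoint.smul_infty_eq_self_iff] at hi
  have hdet : A 0 0 * A 1 1 ≠ 0 := by
    have := A.det_ne_zero
    rwa [Matrix.det_fin_two, hi, mul_zero, sub_zero] at this
  have h11 : A 1 1 ≠ 0 := right_ne_zero_of_mul hdet
  rw [hA, t0, OnePoint.smul_some_eq_ite, hi, zero_mul, zero_add, if_neg h11, mul_zero, zero_add,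
    OnePoint.coe_eq_coe, div_eq_zero_iff, or_iff_left h11] at h0
  rw [hA, t1, OnePoint.smul_some_eq_ite, hi, h0, zero_mul, zero_add, if_neg h11, mul_one, add_zero,
    OnePoint.coe_eq_coe, div_eq_one_iff_eq h11] at h1
  -- The three fixed points make A scalar, so its determinant is a square. This excludes ω ↦ ω³,
  -- which also fixes ∞, 0 and 1.
  have hsq : IsSquare (Matrix.GeneralLinearGroup.det A) := by
    refine ⟨Units.mk0 _ h11, Units.ext ?_⟩
    rw [Matrix.GeneralLinearGroup.val_det_apply, Matrix.det_fin_two, hi, mul_zero, sub_zero, h1]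
    rfl
  ext1 ω
  rw [hA, twist_of_isSquare hsq, Equiv.Perm.one_apply]
  induction ω using OnePoint.rec with
  | infty => rwa [OnePoint.smul_infty_eq_self_iff]
  | coe x =>
    rw [OnePoint.smul_some_eq_ite, hi, h0, h1, zero_mul, zero_add, if_neg h11, add_zero,
      mul_div_cancel_left₀ _ h11]

/-- Here -1 = ζ⁴. It is the determinant of the matrices of T and J, which are therefore untwisted.
-/
lemma isSquare_neg_one_units {u : Kˣ} (hu : (u : K) = -1) {ζ : K} (hζ : ζ ^ 2 = 1 - ζ) :
    IsSquare u := by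
  refine ⟨Units.mk0 ζ (zeta_ne_zero ζ hζ) ^ 2, Units.ext ?_⟩
  rw [hu]
  simp only [Units.val_mul, Units.val_pow_eq_pow_val, Units.val_mk0]
  linear_combination (-ζ ^ 2 + ζ - 2) * hζ + (ζ - 1) * three_eq_zero

/-- The fourth power of a square is 1, as the unit group has order 8, but ζ⁻⁴ = -1. This is the
determinant of the matrix of a, and explains the twist ω³ there. -/
lemma not_isSquare_of_coe_eq {u : Kˣ} {ζ : K} (hζ : ζ ^ 2 = 1 - ζ) (hu : (u : K) = ζ⁻¹) :
    ¬ IsSquare u := by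
  rintro ⟨w, rfl⟩
  have h8 : (w : K) ^ 8 = 1 := by
    have : Fintype K := Fintype.ofFinite K
    have h := FiniteField.pow_card_sub_one_eq_one (w : K) w.ne_zero
    rwa [← Nat.card_eq_fintype_card, card_K] at h
  have hz4 : ζ ^ 4 = -1 := by
    linear_combination (ζ ^ 2 - ζ + 2) * hζ - (ζ - 1) * three_eq_zero
  have h4 : ((w * w : Kˣ) : K) ^ 4 = 1 := by
    rw [← h8, Units.val_mul]
    ring
  rw [hu, inv_pow, hz4, inv_neg, inv_one] at h4
  have h2 : (2 : K) = 0 := by linear_combination -h4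
  exact one_ne_zero (α := K) (by linear_combination three_eq_zero - h2)

open scoped Classical in
lemma action_mem_map_M9 (ζ : K) (hζ : ζ ^ 2 = 1 - ζ) {g : PresentedGroup rels} (hg : g ∈ genM9) :
    action ζ hζ g ∈ M9.map extendHom := by
  have ha : gen .a ∈ (M9.map extendHom).comap (action ζ hζ) := by
    have hz := inv_ne_zero (zeta_ne_zero ζ hζ)
    refine mem_map_M9 (Matrix.GeneralLinearGroup.mkOfDetNeZero !![ζ⁻¹, 0; 0, 1]
      (by simpa [Matrix.det_fin_two] using hz)) (action_a ζ hζ none) fun ω => ?_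
    rw [action_a, twist, if_neg (not_isSquare_of_coe_eq hζ (by
      simp [Matrix.GeneralLinearGroup.mkOfDetNeZero, Matrix.det_fin_two]))]
    induction ω using OnePoint.rec with
    | infty =>
      rw [OnePoint.map_infty, OnePoint.smul_infty_eq_self_iff.2] <;>
        simp [Matrix.GeneralLinearGroup.mkOfDetNeZero, aMap]
    | coe x =>
      rw [OnePoint.map_some, OnePoint.smul_some_eq_ite]
      simp [Matrix.GeneralLinearGroup.mkOfDetNeZero, aMap, conj, frobenius_def]
  have hT : gen .T ∈ (M9.map extendHom).comap (action ζ hζ) := by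
    refine mem_map_M9 (Matrix.GeneralLinearGroup.mkOfDetNeZero !![-1, 1; 0, 1]
      (by simp [Matrix.det_fin_two])) (action_T ζ hζ none) fun ω => ?_
    rw [action_T, twist_of_isSquare (isSquare_neg_one_units (by
      simp [Matrix.GeneralLinearGroup.mkOfDetNeZero, Matrix.det_fin_two]) hζ)]
    induction ω using OnePoint.rec with
    | infty =>
      rw [OnePoint.smul_infty_eq_self_iff.2] <;>
        simp [Matrix.GeneralLinearGroup.mkOfDetNeZero, tMap]
    | coe x =>
      rw [OnePoint.smul_some_eq_ite]
      simp [Matrix.GeneralLinearGroup.mkOfDetNeZero, tMap, sub_eq_neg_add]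
  have hJ : gen .J ∈ (M9.map extendHom).comap (action ζ hζ) := by
    refine mem_map_M9 (Matrix.GeneralLinearGroup.mkOfDetNeZero !![0, 1; 1, 0]
      (by simp [Matrix.det_fin_two])) (action_J ζ hζ none) fun ω => ?_
    rw [action_J, twist_of_isSquare (isSquare_neg_one_units (by
      simp [Matrix.GeneralLinearGroup.mkOfDetNeZero, Matrix.det_fin_two]) hζ)]
    induction ω using OnePoint.rec with
    | infty =>
      rw [OnePoint.smul_infty_eq_ite]
      simp [Matrix.GeneralLinearGroup.mkOfDetNeZero, jMap]
    | coe x =>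
      rw [OnePoint.smul_some_eq_ite]
      simp [Matrix.GeneralLinearGroup.mkOfDetNeZero, jMap]
      split_ifs <;> rfl
  have hle : genM9 ≤ (M9.map extendHom).comap (action ζ hζ) := by
    rw [Subgroup.closure_le]
    rintro x (rfl | rfl | rfl | rfl)
    · exact ha
    · exact mul_mem (mul_mem (mul_mem hJ ha) (inv_mem hJ)) (inv_mem ha)
    · exact hT
    · exact hJ
  exact hle hg

/-- By triple transitivity some g in ⟨a, T, J⟩ takes h(∞), h(0), h(1) back to ∞, 0, 1. Since g acts
through M(3²), its product with h is trivial by rigidity, and h is the action of g⁻¹. -/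
lemma map_M9_le_range (ζ : K) (hζ : ζ ^ 2 = 1 - ζ) :
    M9.map extendHom ≤ (action ζ hζ).range := by
  rintro _ ⟨h, hh, rfl⟩
  obtain ⟨c, hc⟩ : ∃ c : Option (ZMod 3 × ZMod 3) ≃ Line,
      ∀ p, pointEquiv ζ hζ (some p) = some (c p) :=
    ⟨Equiv.optionCongr (coord ζ hζ), fun _ => rfl⟩
  have hinj := c.symm.injective.comp h.injective
  obtain ⟨g, hg, hi, h0, h1⟩ := exists_act_eq
    (p := c.symm (h OnePoint.infty)) (q := c.symm (h (OnePoint.some 0)))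
    (r := c.symm (h (OnePoint.some 1)))
    (hinj.ne (OnePoint.infty_ne_coe _)) (hinj.ne (OnePoint.infty_ne_coe _))
    (hinj.ne (OnePoint.coe_injective.ne zero_ne_one))
  have key : ∀ ω y, act g (some (c.symm (h ω))) = y →
      action ζ hζ g (some (h ω)) = pointEquiv ζ hζ y := by
    intro ω y hy
    rw [← hy, ← action_pointEquiv, hc, Equiv.apply_symm_apply]
  obtain ⟨k, hk, hkg⟩ := action_mem_map_M9 ζ hζ hg
  have key' : ∀ ω ω' y, act g (some (c.symm (h ω))) = y → pointEquiv ζ hζ y = some ω' →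
      (k * h) ω = ω' := by
    intro ω ω' y hy hω'
    apply Option.some_injective
    rw [← hω', ← key ω y hy, ← hkg, extendHom_some, Equiv.Perm.mul_apply]
  have hone : k * h = 1 := eq_one_of_mem_M9 (mul_mem hk hh) (key' _ _ _ hi rfl)
    (key' _ _ _ h0 (by rw [pointEquiv_some, coord_zero]))
    (key' _ _ _ h1 (by rw [pointEquiv_some, coord_one]))
  refine ⟨g⁻¹, ?_⟩
  rw [map_inv, ← hkg, ← map_inv, inv_eq_of_mul_eq_one_right hone]

end Zassenhaus

/-! ### The image is M₁₁ -/

lemma range_action (ζ : K) (hζ : ζ ^ 2 = 1 - ζ) : (action ζ hζ).range = M11 ζ hζ := by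
  have hsub : M9.map extendHom ≤ M11 ζ hζ := by
    rintro _ ⟨h, hh, rfl⟩
    exact Subgroup.subset_closure (Or.inl ⟨h, hh, rfl⟩)
  apply le_antisymm
  · rw [MonoidHom.range_eq_map, ← closure_gen_eq_top, Subgroup.map_le_iff_le_comap,
      Subgroup.closure_le]
    have hmem : ∀ g ∈ genM9, g ∈ (M11 ζ hζ).comap (action ζ hζ) :=
      fun g hg => hsub (action_mem_map_M9 ζ hζ hg)
    rintro x (rfl | rfl | rfl | rfl | rfl)
    iterate 4 exact hmem _ (Subgroup.subset_closure (by simp))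
    change action ζ hζ (gen .U) ∈ M11 ζ hζ
    rw [action_U]
    exact Subgroup.subset_closure (Or.inr rfl)
  · rw [M11, Subgroup.closure_le]
    rintro _ (⟨h, hh, rfl⟩ | rfl)
    · exact map_M9_le_range ζ hζ ⟨h, hh, rfl⟩
    · exact ⟨gen .U, action_U ζ hζ⟩

end Mathieu

theorem proposition7p3 (ζ : Mathieu.K) (hζ : ζ ^ 2 = 1 - ζ) :
    ∃ φ : PresentedGroup Mathieu.rels ≃* Mathieu.M11 ζ hζ,
      (∀ ω, (φ (PresentedGroup.of Mathieu.Gen.a) : Equiv.Perm Mathieu.Points) ω =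
        Mathieu.aMap ζ ω) ∧
      (∀ ω, (φ (PresentedGroup.of Mathieu.Gen.T) : Equiv.Perm Mathieu.Points) ω =
        Mathieu.tMap ω) ∧
      (∀ ω, (φ (PresentedGroup.of Mathieu.Gen.J) : Equiv.Perm Mathieu.Points) ω =
        Mathieu.jMap ω) ∧
      (φ (PresentedGroup.of Mathieu.Gen.U) : Equiv.Perm Mathieu.Points) = Mathieu.S4 ζ hζ :=
  ⟨(MonoidHom.ofInjective (Mathieu.action_injective ζ hζ)).trans
      (MulEquiv.subgroupCongr (Mathieu.range_action ζ hζ)),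
    Mathieu.action_a ζ hζ, Mathieu.action_T ζ hζ, Mathieu.action_J ζ hζ, Mathieu.action_U ζ hζ⟩
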